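/- **Setting.** Let $X\subset\mathbb R^n$ be compact, any two of its points being joined by a path of finite length in $X$, and let $d(p,q)$ be the length of a shortest path in $X$ from $p$ to $q$. Let $\varphi:X\to[0,\infty)$ be measurable with $\int_X\varphi=1$, and let $f:[0,\infty)\to[0,\infty)$ be strictly increasing and subadditive. For $m\ge1$ robots at $Q=(q_1,\dots,q_m)\in X^m$ put $$\mathcal H(Q)=\int_X\min_i f(d(p,q_i))\,\varphi(p)\,dp .$$ Let $S\subset X$ be a finite set of samples with dispersion $\zeta=\sup_{p\in X}\min_{u\in S}d(p,u)<\infty$. For $p\in X$ let $\sigma^{-1}(p)\in S$ be a closest sample (ties are broken by any rule for which the cells $\{p\in X:\sigma^{-1}(p)=v\}$ are measurable). For $u,v\in S$ put $c(u,v)=f(d(u,v))$ and $w(v)=\int_{\{p\in X:\,\sigma^{-1}(p)=v\}}\varphi(p)\,dp$. For $Q\in S^m$ let $W_i$ be the set of samples $u$ with $c(u,q_i)\le c(u,q_j)$ for all $j$, ties being won by the smaller index, let $V_i=\{p\in X: d(p,q_i)\le d(p,q_j)\ \forall j\}$ and $r_i=\sup_{p\in V_i}d(p,q_i)$. The neighbours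 of robot $i$ are $N(i)=\{j: d(q_i,q_j)\le4\max(r_i,r_j)\}$, which contains $i$; put $O_i=\{q_j: j\in N(i),\ j\ne i\}$. **Algorithm** (threshold $\epsilon_0>0$, any initial configuration $Q_0\in S^m$). All robots start active. While some robot is active, an arbitrary active robot $i$ takes a turn: if $\sum_{u\in W_i}c(u,q_i)>0$, it performs local moves as long as one is available; then it becomes inactive. If the configuration was changed during the turn, all other robots become active (again). The algorithm stops, and returns the current configuration, when all robots are inactive. A local move of robot $i$ is one of the following. 1. For $v\in W_i$ let $\delta_v=\sum_{j\in N(i)}\sum_{u\in W_j}w(u)\big[\min_{x\in O_i\cup\{v\}}c(u,x)-c(u,q_j)\big]$. If $\min_{v\in W_i}\delta_v\le-\epsilon_0$, robot $i$ moves to a minimizer $v$. 2. Otherwise, for $v\in W_i$ let $\rho_v=\sum_{j\in N(i)}\sum_{u\in R_j(v)}w(u)[c(u,v)-c(u,q_j)]$ with $R_j(v)=\{u\in W_j:c(u,v)<c(u,q_j)\}$. Robot $i$ sends $(\rho_v)_{v\in W_i}$ with counter $1$ to its neighbours. Each other robot $k$ treats only the message with the smallest counter that it receives, and a neighbour that sent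 it is its parent. If the counter is $1$, robot $k$ computes $\ell_v=\sum_{u\in W_k\setminus R_k(v)}w(u)\big[\min_{x\in O_k\cup\{v\}}c(u,x)-c(u,q_k)\big]$; if the counter is larger, it computes $\ell_v=\ell=\sum_{u\in W_k}w(u)\big[\min_{x\in O_k}c(u,x)-c(u,q_k)\big]$. If $\rho_v+\ell_v\le-\epsilon_0$ for some $v\in W_i$, it accepts; otherwise it forwards the message to its neighbours with the counter increased by one. If some robot accepts, a pair (accepting robot $k$, vertex $v$) with the least $\rho_v+\ell_v$ is selected; then robot $i$ moves to $v$, and each other robot on the chain of parents from $k$ to $i$ moves to the previous position of its parent. **Statement.** From every initial configuration the algorithm returns some configuration, and every configuration $Q$ that it can return satisfies, for every minimizer $S^*$ of $\mathcal H$ over $X^m$, $$\mathcal H(Q)\le 5\,\mathcal H(S^*)+21\,f(\zeta)+m\,\epsilon_0 .$$ In particular $\mathcal H(Q)\le5\,\mathcal H(S^*)+O(f(\zeta)+\epsilon_0)$, with a constant that depends only on $m$. -/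

import Mathlib

open scoped ENNReal NNReal

noncomputable section

namespace Coverage

/-- Points of the ambient Euclidean space `ℝⁿ`. -/
abbrev Loc (n : ℕ) := EuclideanSpace ℝ (Fin n)

/-- Infimum of the lengths of the continuous paths inside `X` from `p` to `q` (the length of a path
is its total variation); it is `∞` if there is no path of finite length. -/
def pathEDist {n : ℕ} (X : Set (Loc n)) (p q : Loc n) : ℝ≥0∞ :=
  ⨅ (γ : ℝ → Loc n) (_ : ContinuousOn γ (Set.Icc 0 1) ∧ Set.MapsTo γ (Set.Icc 0 1) X ∧
    γ 0 = p ∧ γ 1 = q), eVariationOn γ (Set.Icc 0 1)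

/-- A continuous coverage problem in `ℝⁿ`. -/
structure Problem (n : ℕ) where
  /-- the obstacle-free part of the environment -/
  X : Set (Loc n)
  isCompact_X : IsCompact X
  /-- any two locations are joined inside `X` by a path of finite length -/
  connected : ∀ p ∈ X, ∀ q ∈ X, pathEDist X p q ≠ ∞
  /-- the density of the event distribution -/
  φ : Loc n → ℝ≥0
  aemeasurable_φ : AEMeasurable φ (MeasureTheory.volume.restrict X)
  mass_one : ∫⁻ p in X, (φ p : ℝ≥0∞) = 1
  /-- the sensing function -/
  f : ℝ≥0 → ℝ≥0
  strictMono_f : StrictMono f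
  subadditive_f : ∀ x y, f (x + y) ≤ f x + f y

namespace Problem

variable {n : ℕ} (P : Problem n) {m : ℕ}

/-- The length of a shortest path in the environment between two locations. -/
def dist (p q : Loc n) : ℝ≥0 := (pathEDist P.X p q).toNNReal

/-- The continuous coverage cost `ℋ(Q) = ∫_X min_i f (d (p, q_i)) φ(p) dp`. -/
def cost (Q : Fin m → Loc n) : ℝ≥0∞ :=
  ∫⁻ p in P.X, (⨅ i, (P.f (P.dist p (Q i)) : ℝ≥0∞)) * (P.φ p : ℝ≥0∞)

/-- `Q` minimizes the coverage cost among all configurations of `m` robots in the environment. -/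
def IsOptimal (Q : Fin m → Loc n) : Prop :=
  (∀ i, Q i ∈ P.X) ∧ ∀ Q' : Fin m → Loc n, (∀ i, Q' i ∈ P.X) → P.cost Q ≤ P.cost Q'

/-- The Voronoi cell of robot `i` in the continuous environment. -/
def voronoi (Q : Fin m → Loc n) (i : Fin m) : Set (Loc n) :=
  {p | p ∈ P.X ∧ ∀ j, P.dist p (Q i) ≤ P.dist p (Q j)}

/-- The largest distance of robot `i` from a point of its Voronoi cell. -/
def radius (Q : Fin m → Loc n) (i : Fin m) : ℝ≥0 :=
  sSup ((fun p => P.dist p (Q i)) '' P.voronoi Q i)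

/-- The neighbours of robot `i`; robot `i` is one of them. -/
def neighbors (Q : Fin m → Loc n) (i : Fin m) : Finset (Fin m) :=
  {j | P.dist (Q i) (Q j) ≤ 4 * max (P.radius Q i) (P.radius Q j)}

/-- A finite set of sampled locations, with a choice `near p` of a closest sample for every location
`p`. Ties are broken by `near`, so that the cells of the samples form a partition of the
environment. -/
structure Sampling where
  S : Finset (Loc n)
  subset_X : ∀ v ∈ S, v ∈ P.X
  near : Loc n → {v // v ∈ S}
  dist_near_le : ∀ p ∈ P.X, ∀ u ∈ S, P.dist p (near p) ≤ P.dist p u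
  measurableSet_cell : ∀ v, MeasurableSet {p | p ∈ P.X ∧ near p = v}

end Problem

namespace Problem.Sampling

variable {n : ℕ} {P : Problem n} (𝒮 : P.Sampling) {m : ℕ}

/-- The vertices of the graph, that is, the sampled locations. -/
abbrev V : Type := {v : Loc n // v ∈ 𝒮.S}

/-- A configuration of `m` robots on the vertices. The identifier of a robot is its index. -/
abbrev Config (m : ℕ) : Type := Fin m → 𝒮.V

/-- `ζ` is the dispersion of the sampling: the supremum over all locations of the distance to the
closest sample. -/
def IsDispersion (ζ : ℝ≥0) : Prop :=
  IsLUB ((fun p : Loc n => ⨅ u : 𝒮.V, P.dist p u) '' P.X) ζ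

/-- The edge cost. -/
def c (u v : 𝒮.V) : ℝ := P.f (P.dist u v)

/-- The weight of a vertex: the mass of the set of locations whose chosen closest sample it is. -/
def w (v : 𝒮.V) : ℝ := (∫⁻ p in {p | p ∈ P.X ∧ 𝒮.near p = v}, (P.φ p : ℝ≥0∞)).toReal

/-- The locations of the robots of a configuration. -/
def loc (q : 𝒮.Config m) : Fin m → Loc n := fun i => q i

/-- The partition of robot `i`: the vertices closer to it than to any other robot, where ties are
won by the robot with the smaller identifier. -/
def part (q : 𝒮.Config m) (i : Fin m) : Finset 𝒮.V :=
  open Classical in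
  {u | ∀ j, j ≠ i → 𝒮.c u (q i) < 𝒮.c u (q j) ∨ (𝒮.c u (q i) = 𝒮.c u (q j) ∧ i < j)}

/-- The neighbours of robot `i` (with `i` among them). -/
def nbr (q : 𝒮.Config m) (i : Fin m) : Finset (Fin m) := P.neighbors (𝒮.loc q) i

/-- The positions of the neighbours of robot `i` other than `i`. -/
def others (q : 𝒮.Config m) (i : Fin m) : Set 𝒮.V := {x | ∃ j ∈ 𝒮.nbr q i, j ≠ i ∧ x = q j}

/-- The least cost from `u` to an element of the set `T`. -/
def minCost (u : 𝒮.V) (T : Set 𝒮.V) : ℝ := sInf ((fun x => 𝒮.c u x) '' T)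

/-- The change `δ_v` of the local objective if robot `i` moves to `v`. -/
def delta (q : 𝒮.Config m) (i : Fin m) (v : 𝒮.V) : ℝ :=
  ∑ j ∈ 𝒮.nbr q i, ∑ u ∈ 𝒮.part q j,
    𝒮.w u * (𝒮.minCost u (insert v (𝒮.others q i)) - 𝒮.c u (q j))

/-- The vertices `R_j(v)` in the partition of robot `j` that are closer to `v` than to robot `j`. -/
def gained (q : 𝒮.Config m) (j : Fin m) (v : 𝒮.V) : Finset 𝒮.V :=
  open Classical in {u ∈ 𝒮.part q j | 𝒮.c u v < 𝒮.c u (q j)}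

/-- The change `ρ_v` of the local objective if robot `i` moves to `v` and a new robot appears at the
old position of `i`. -/
def rho (q : 𝒮.Config m) (i : Fin m) (v : 𝒮.V) : ℝ :=
  ∑ j ∈ 𝒮.nbr q i, ∑ u ∈ 𝒮.gained q j v, 𝒮.w u * (𝒮.c u v - 𝒮.c u (q j))

/-- The change `ℓ_v` computed by a robot `k` that receives the message with counter one. -/
def ellNear (q : 𝒮.Config m) (k : Fin m) (v : 𝒮.V) : ℝ :=
  open Classical in
  ∑ u ∈ 𝒮.part q k \ 𝒮.gained q k v,
    𝒮.w u * (𝒮.minCost u (insert v (𝒮.others q k)) - 𝒮.c u (q k))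

/-- The change `ℓ` computed by a robot `k` that receives the message with a counter above one. -/
def ellFar (q : 𝒮.Config m) (k : Fin m) : ℝ :=
  ∑ u ∈ 𝒮.part q k, 𝒮.w u * (𝒮.minCost u (𝒮.others q k) - 𝒮.c u (q k))

/-- The total change that robot `k` associates with the vertex `v` offered by robot `i`, when the
message reaches it with counter `h`. -/
def value (q : 𝒮.Config m) (i : Fin m) (h : ℕ) (k : Fin m) (v : 𝒮.V) : ℝ :=
  𝒮.rho q i v + if h = 1 then 𝒮.ellNear q k v else 𝒮.ellFar q k

/-- Robot `k`, reached by the message of robot `i` with counter `h`, accepts. -/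
def Accepts (ε₀ : ℝ≥0) (q : 𝒮.Config m) (i : Fin m) (h : ℕ) (k : Fin m) : Prop :=
  ∃ v ∈ 𝒮.part q i, 𝒮.value q i h k v ≤ -ε₀

/-- Robot `k`, reached with counter `h`, sends the message to its neighbours with counter `h + 1`:
this is done by the originator (`h = 0`) and by every robot that does not accept. -/
def Forwards (ε₀ : ℝ≥0) (q : 𝒮.Config m) (i : Fin m) (h : ℕ) (k : Fin m) : Prop :=
  h = 0 ∨ ¬ 𝒮.Accepts ε₀ q i h k

/-- The propagation of the message of robot `i`. The first component for `h` is the set of robots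
for which the smallest counter of a received message is `h` (the originator for `h = 0`), the second
component is the set of robots reached with a counter at most `h`. -/
def flood (ε₀ : ℝ≥0) (q : 𝒮.Config m) (i : Fin m) : ℕ → Finset (Fin m) × Finset (Fin m)
  | 0 => ({i}, {i})
  | h + 1 =>
    open Classical in
    let s := flood ε₀ q i h
    let new : Finset (Fin m) :=
      {k | k ∉ s.2 ∧ ∃ p ∈ s.1, 𝒮.Forwards ε₀ q i h p ∧ k ∈ 𝒮.nbr q p}
    (new, s.2 ∪ new)

/-- Robot `k` is reached by the message of robot `i`, with smallest counter `h`. -/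
def Reached (ε₀ : ℝ≥0) (q : 𝒮.Config m) (i : Fin m) (h : ℕ) (k : Fin m) : Prop :=
  k ∈ (𝒮.flood ε₀ q i h).1

/-- One iteration of the local move procedure of robot `i` that changes the configuration `q` to
`q'`. -/
inductive LocalMove (ε₀ : ℝ≥0) (i : Fin m) (q q' : 𝒮.Config m) : Prop
  /-- Robot `i` moves inside its partition to a vertex with the least change. -/
  | single (v : 𝒮.V) (hv : v ∈ 𝒮.part q i)
      (improves : 𝒮.delta q i v ≤ -ε₀)
      (best : ∀ v' ∈ 𝒮.part q i, 𝒮.delta q i v ≤ 𝒮.delta q i v')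
      (move : q' = Function.update q i v)
  /-- There is no move of the first kind. The message of robot `i` has travelled along
  `i = r 0, r 1, …, r h`, where `r t` is the parent of `r (t + 1)`, and `r h` has accepted; its
  answer is the best of all answers. Robot `i` moves to `v`, and each other robot of the chain moves
  to the position of its parent. -/
  | chain (noSingle : ∀ v' ∈ 𝒮.part q i, ¬ 𝒮.delta q i v' ≤ -ε₀)
      (h : ℕ) (hpos : 1 ≤ h) (r : ℕ → Fin m)
      (start : r 0 = i)
      (reached : ∀ t ≤ h, 𝒮.Reached ε₀ q i t (r t))
      (parent : ∀ t < h, 𝒮.Forwards ε₀ q i t (r t) ∧ r (t + 1) ∈ 𝒮.nbr q (r t))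
      (v : 𝒮.V) (hv : v ∈ 𝒮.part q i)
      (improves : 𝒮.value q i h (r h) v ≤ -ε₀)
      (best : ∀ h' k', 1 ≤ h' → 𝒮.Reached ε₀ q i h' k' → ∀ v' ∈ 𝒮.part q i,
        𝒮.value q i h (r h) v ≤ 𝒮.value q i h' k' v')
      (move_start : q' i = v)
      (move_chain : ∀ t < h, q' (r (t + 1)) = q (r t))
      (stay : ∀ j, (∀ t ≤ h, j ≠ r t) → q' j = q j)

/-- A state of the algorithm: the configuration and the set of active robots. -/
abbrev State (m : ℕ) : Type := 𝒮.Config m × Finset (Fin m)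

/-- The turn of an active robot `i`. If `∑_{u ∈ W_i} c (u, q_i)` is positive, robot `i` performs local
moves as long as there is one. It then becomes inactive. If the configuration has been changed during
the turn, then all other robots are active afterwards, since new moves may be available to them. -/
inductive Turn (ε₀ : ℝ≥0) : 𝒮.State m → 𝒮.State m → Prop
  | skip (q : 𝒮.Config m) (A : Finset (Fin m)) (i : Fin m) (hi : i ∈ A)
      (guard : ¬ 0 < ∑ u ∈ 𝒮.part q i, 𝒮.c u (q i)) :
      Turn ε₀ (q, A) (q, A.erase i)
  | noMove (q : 𝒮.Config m) (A : Finset (Fin m)) (i : Fin m) (hi : i ∈ A)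
      (guard : 0 < ∑ u ∈ 𝒮.part q i, 𝒮.c u (q i))
      (done : ∀ q', ¬ 𝒮.LocalMove ε₀ i q q') :
      Turn ε₀ (q, A) (q, A.erase i)
  | moves (q q' : 𝒮.Config m) (A : Finset (Fin m)) (i : Fin m) (hi : i ∈ A)
      (guard : 0 < ∑ u ∈ 𝒮.part q i, 𝒮.c u (q i))
      (run : Relation.TransGen (𝒮.LocalMove ε₀ i) q q')
      (done : ∀ q'', ¬ 𝒮.LocalMove ε₀ i q' q'') :
      Turn ε₀ (q, A) (q', Finset.univ.erase i)

/-- Some execution of the distributed coverage algorithm with improvement threshold `ε₀`, started in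
`q₀` with all robots active, ends in `q` with all robots inactive. -/
def Returns (ε₀ : ℝ≥0) (q₀ q : 𝒮.Config m) : Prop :=
  Relation.ReflTransGen (𝒮.Turn ε₀) (q₀, Finset.univ) (q, ∅)

end Problem.Sampling

end Coverage

end

/-!
Replacing every location by its sample turns `ℋ` into a weighted median cost on the samples. This
changes the cost by at most `f ζ` for a configuration on the samples, and by at most `2 f ζ` when
the robots of an arbitrary configuration are rounded as well.

The local computations of the robots are exact. A shortest path from a point of the cell of robot
`k` to a point outside of it enters the cell of a neighbour of `k` as soon as it leaves the cell of
`k`; hence the vertices that `k` serves can be handed over to neighbours of `k`, and the quantities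
`δ_v` and `ρ_v + ℓ_v` are the changes of the median cost when a single robot moves to `v`. Shifting
a chain of robots has the same effect on the set of positions as moving its last robot to `v`.
So every local move lowers the median cost by at least `ε₀`, which forces termination. Conversely,
since the cells also connect all robots, a message that nobody accepts reaches every robot; so in a
returned configuration no relocation of a single robot gains `ε₀` or more.

Such a single-swap local optimum of the metric median problem is within a factor `5` of any
competitor: each centre `x` of the competitor is paired with a centre `σ x` that captures no centre
of the competitor except possibly `x`, in such a way that no centre is used more than twice, and the
`m` inequalities for the swaps of `σ x` for `x` are summed up. The total error is `5 · 2 + 1 = 11`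
times `f ζ`.
-/

noncomputable section

namespace Coverage

section LocalSearch

open Function
open scoped Finset

variable {ι κ α : Type*}

theorem le_ciInf_update_iff {β : Type*} [ConditionallyCompleteLattice β] [Finite κ] [DecidableEq κ]
    {g : α → β} {q : κ → α} {k : κ} {v : α} {a : β} :
    a ≤ ⨅ i, g (update q k v i) ↔ a ≤ g v ∧ ∀ j ≠ k, a ≤ g (q j) := by
  have : Nonempty κ := ⟨k⟩
  rw [le_ciInf_iff (Set.finite_range _).bddBelow, forall_update_iff q fun _ x => a ≤ g x]

section SwapAssignment

variable [Fintype ι] [Fintype κ] [DecidableEq κ]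

theorem card_le_two_mul_card_swappable [DecidableEq ι] (hcard : Fintype.card ι ≤ Fintype.card κ)
    (η : ι → κ) (A : Finset ι) : #A ≤ 2 * #{s | ∃ x ∈ A, ∀ y, η y = s → y = x} := by
  set N : Finset κ := {s | ∃ x ∈ A, ∀ y, η y = s → y = x}
  obtain rfl | ⟨x, hx⟩ := A.eq_empty_or_nonempty
  · simp
  have two_le (s) (hs : s ∈ Nᶜ) : 2 ≤ #{y | η y = s} + #{y ∈ Aᶜ | η y = s} := by
    simp only [N, Finset.mem_compl, Finset.mem_filter_univ, not_exists, not_and, not_forall] at hs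
    obtain ⟨y, rfl, -⟩ := hs x hx
    have one_le : 1 ≤ #{z | η z = η y} := Finset.card_pos.2 ⟨y, by simp⟩
    by_cases hyA : y ∈ A
    · obtain ⟨z, hz, hzy⟩ := hs y hyA
      have := Finset.one_lt_card.2
        ⟨z, (Finset.mem_filter_univ (p := fun z => η z = η y) z).2 hz, y, by simp, hzy⟩
      lia
    · have : 1 ≤ #{z ∈ Aᶜ | η z = η y} := Finset.card_pos.2 ⟨y, by simp [hyA]⟩
      lia
  have sum_fibers (B : Finset ι) : ∑ s ∈ Nᶜ, #{y ∈ B | η y = s} ≤ #B := by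
    rw [Finset.card_eq_sum_card_fiberwise (f := η) (t := Finset.univ) fun _ _ => Finset.mem_univ _]
    exact Finset.sum_le_sum_of_subset (Finset.subset_univ _)
  have count := Finset.card_nsmul_le_sum Nᶜ _ 2 two_le
  rw [Finset.sum_add_distrib, smul_eq_mul] at count
  have := (sum_fibers Finset.univ).trans_eq Finset.card_univ
  have := sum_fibers Aᶜ
  have := N.card_add_card_compl
  have := A.card_add_card_compl
  lia

theorem exists_swap_assignment (hcard : Fintype.card ι ≤ Fintype.card κ) (η : ι → κ) :
    ∃ σ : ι → κ, (∀ s, #{x | σ x = s} ≤ 2) ∧ ∀ x y, η y = σ x → y = x := by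
  classical
  let swappable (x : ι) : Finset κ := {s | ∀ y, η y = s → y = x}
  -- Hall's theorem is applied with two copies of every element of `κ`.
  obtain ⟨τ, τ_injective, hτ⟩ :=
    (Finset.all_card_le_biUnion_card_iff_exists_injective
      fun x => swappable x ×ˢ (Finset.univ : Finset Bool)).1 fun A => by
      have : (A.biUnion fun x => swappable x ×ˢ (Finset.univ : Finset Bool)) =
          ({s | ∃ x ∈ A, ∀ y, η y = s → y = x} : Finset κ) ×ˢ Finset.univ := by
        ext; simp [swappable]
      rw [this, Finset.card_product, Finset.card_univ, Fintype.card_bool, mul_comm]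
      exact card_le_two_mul_card_swappable hcard η A
  refine ⟨fun x => (τ x).1, fun s => ?_, fun x => by simpa [swappable] using hτ x⟩
  calc #{x | (τ x).1 = s} ≤ #({s} ×ˢ (Finset.univ : Finset Bool)) :=
        Finset.card_le_card_of_injOn τ (fun x hx => by
          simpa [Prod.ext_iff, ← and_or_left] using hx) τ_injective.injOn
    _ = 2 := by simp

end SwapAssignment

/-- The weighted median cost of the centres `q`: every client `u ∈ s` pays its weight times the
cost of its cheapest centre. -/
def medianCost (s : Finset α) (w : α → ℝ) (c : α → α → ℝ) (q : κ → α) : ℝ :=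
  ∑ u ∈ s, w u * ⨅ i, c u (q i)

variable {c : α → α → ℝ}

theorem nonneg_of_symm_of_triangle (symm : ∀ u v, c u v = c v u)
    (triangle : ∀ u v x, c u x ≤ c u v + c v x) (u v : α) : 0 ≤ c u v := by
  linarith [triangle u v u, triangle u u v, symm u v]

theorem reassign_le (symm : ∀ u v, c u v = c v u) (triangle : ∀ u v x, c u x ≤ c u v + c v x)
    {u x y z : α} (hz : c x z ≤ c x y) : c u z ≤ c u y + 2 * c u x := by
  linarith [triangle u x z, triangle x u y, symm x u]

section

variable [DecidableEq κ]

theorem ciInf_update_le_add_of_swap [Finite κ] [DecidableEq ι] (symm : ∀ u v, c u v = c v u)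
    (triangle : ∀ u v x, c u x ≤ c u v + c v x) {q : κ → α} {o : ι → α} {η : ι → κ}
    (hη : ∀ x k, c (o x) (q (η x)) ≤ c (o x) (q k)) {u : α} {x b : ι} {k a : κ}
    (hk : ∀ y, η y = k → y = x) :
    ⨅ i, c u (update q k (o x) i) ≤ c u (q a) + ((if x = b then c u (o b) - c u (q a) else 0) +
      if k = a then 2 * c u (o b) else 0) := by
  have nonneg := nonneg_of_symm_of_triangle symm triangle u (o b)
  obtain ⟨le_new, le_old⟩ := (le_ciInf_update_iff (g := c u) (q := q) (k := k) (v := o x)).1 le_rfl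
  split_ifs with hxb hka hka
  · subst hxb; linarith
  · subst hxb; linarith
  · have := le_old (η b) fun h => hxb (hk b h).symm
    linarith [reassign_le symm triangle (u := u) (hη b a)]
  · linarith [le_old a (Ne.symm hka)]

theorem sum_ciInf_update_le [Fintype ι] [Finite κ] [Nonempty ι] [Nonempty κ]
    (symm : ∀ u v, c u v = c v u)
    (triangle : ∀ u v x, c u x ≤ c u v + c v x) {q : κ → α} {o : ι → α}
    {η σ : ι → κ} (hη : ∀ x k, c (o x) (q (η x)) ≤ c (o x) (q k))
    (hσ : ∀ k, #{x | σ x = k} ≤ 2) (hσ' : ∀ x y, η y = σ x → y = x) (u : α) :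
    ∑ x, ((⨅ i, c u (update q (σ x) (o x) i)) - ⨅ i, c u (q i)) ≤
      (5 * ⨅ x, c u (o x)) - ⨅ i, c u (q i) := by
  classical
  obtain ⟨a, ha⟩ := exists_eq_ciInf_of_finite (f := fun i => c u (q i))
  obtain ⟨b, hb⟩ := exists_eq_ciInf_of_finite (f := fun x => c u (o x))
  have fiber : (#{x | σ x = a} : ℝ) ≤ 2 := mod_cast hσ a
  calc ∑ x, ((⨅ i, c u (update q (σ x) (o x) i)) - ⨅ i, c u (q i))
      ≤ ∑ x, ((if x = b then c u (o b) - c u (q a) else 0) +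
          if σ x = a then 2 * c u (o b) else 0) := Finset.sum_le_sum fun x _ => by
        rw [← ha, tsub_le_iff_left]
        exact ciInf_update_le_add_of_swap symm triangle hη (hσ' x)
    _ = c u (o b) - c u (q a) + #{x | σ x = a} * (2 * c u (o b)) := by
        rw [Finset.sum_add_distrib, Finset.sum_ite_eq', if_pos (Finset.mem_univ b),
          ← Finset.sum_filter, Finset.sum_const, nsmul_eq_mul]
    _ ≤ (5 * ⨅ x, c u (o x)) - ⨅ i, c u (q i) := by
        rw [← ha, ← hb]
        nlinarith [nonneg_of_symm_of_triangle symm triangle u (o b)]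

theorem medianCost_le_five_mul_of_locallyOptimal [Fintype ι] [Fintype κ] [Nonempty ι]
    (hcard : Fintype.card ι ≤ Fintype.card κ)
    (symm : ∀ u v, c u v = c v u) (triangle : ∀ u v x, c u x ≤ c u v + c v x)
    {s : Finset α} {w : α → ℝ} (hw : ∀ u ∈ s, 0 ≤ w u) {ε : ℝ} {q : κ → α}
    (hq : ∀ k v, medianCost s w c q - ε ≤ medianCost s w c (update q k v)) (o : ι → α) :
    medianCost s w c q ≤ 5 * medianCost s w c o + Fintype.card ι * ε := by
  have : Nonempty κ := Fintype.card_pos_iff.1 (Fintype.card_pos.trans_le hcard)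
  choose η hη using fun x => Finite.exists_min fun k => c (o x) (q k)
  obtain ⟨σ, hσ, hσ'⟩ := exists_swap_assignment hcard η
  have lower : ∑ _x : ι, -ε ≤ ∑ x, (medianCost s w c (update q (σ x) (o x)) - medianCost s w c q) :=
    Finset.sum_le_sum fun x _ => by linarith [hq (σ x) (o x)]
  have upper : ∑ x, (medianCost s w c (update q (σ x) (o x)) - medianCost s w c q) ≤
      5 * medianCost s w c o - medianCost s w c q := by
    simp only [medianCost, Finset.mul_sum, ← Finset.sum_sub_distrib, ← mul_sub]
    rw [Finset.sum_comm]
    refine Finset.sum_le_sum fun u hu => ?_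
    rw [← Finset.mul_sum, mul_left_comm, ← mul_sub]
    exact mul_le_mul_of_nonneg_left (sum_ciInf_update_le symm triangle hη hσ hσ' u) (hw u hu)
  rw [Finset.sum_const, Finset.card_univ, nsmul_eq_mul] at lower
  linarith

end

end LocalSearch

open Filter Function Set Topology

section ChainShift

variable {κ α : Type*}

/-- `q'` arises from `q` by moving the robot `r 0` to `v` and each other robot of the chain
`r 0, …, r h` to the position of its predecessor. -/
structure IsChainShift (q q' : κ → α) (r : ℕ → κ) (h : ℕ) (v : α) : Prop where
  start : q' (r 0) = v
  chain : ∀ t < h, q' (r (t + 1)) = q (r t)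
  stay : ∀ j, (∀ t ≤ h, j ≠ r t) → q' j = q j

theorem exists_isChainShift (q : κ → α) {r : ℕ → κ} {h : ℕ}
    (hr : InjOn r (Iic h)) (v : α) : ∃ q', IsChainShift q q' r h v := by
  classical
  induction h with
  | zero => exact ⟨update q (r 0) v, by simp, by simp, fun j hj => by simp [hj 0 le_rfl]⟩
  | succ h ih =>
    obtain ⟨q', hq'⟩ := ih (hr.mono (Iic_subset_Iic.2 h.le_succ))
    have ne {t : ℕ} (ht : t ≤ h) : r t ≠ r (h + 1) := fun heq => by
      have := hr (mem_Iic.2 (by lia)) self_mem_Iic heq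
      lia
    refine ⟨update q' (r (h + 1)) (q (r h)), ?_, fun t ht => ?_, fun j hj => ?_⟩
    · rw [update_of_ne (ne h.zero_le), hq'.start]
    · obtain rfl | hlt := (Nat.lt_succ_iff.1 ht).eq_or_lt
      · rw [update_self]
      · rw [update_of_ne (ne hlt), hq'.chain t hlt]
    · rw [update_of_ne (hj _ le_rfl), hq'.stay j fun t ht => hj t (by lia)]

theorem IsChainShift.range_eq [DecidableEq κ] {q q' : κ → α} {r : ℕ → κ} {h : ℕ} {v : α}
    (hr : InjOn r (Iic h)) (hq' : IsChainShift q q' r h v) :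
    range q' = range (update q (r h) v) := by
  apply Subset.antisymm
  · rintro _ ⟨j, rfl⟩
    by_cases hj : ∃ t ≤ h, j = r t
    · obtain ⟨_ | t, ht, rfl⟩ := hj
      · exact ⟨r h, by rw [hq'.start, update_self]⟩
      · have : r t ≠ r h := fun heq => by
          have := hr (mem_Iic.2 (by lia)) self_mem_Iic heq
          lia
        exact ⟨r t, by rw [hq'.chain t ht, update_of_ne this]⟩
    · push Not at hj
      exact ⟨j, by rw [hq'.stay j hj, update_of_ne (hj h le_rfl)]⟩
  · rintro _ ⟨j, rfl⟩
    obtain rfl | hjh := eq_or_ne j (r h)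
    · exact ⟨r 0, by rw [hq'.start, update_self]⟩
    rw [update_of_ne hjh]
    by_cases hj : ∃ t ≤ h, j = r t
    · obtain ⟨t, ht, rfl⟩ := hj
      exact ⟨r (t + 1), hq'.chain t (ht.lt_of_ne fun heq => hjh (heq ▸ rfl))⟩
    · push Not at hj
      exact ⟨j, hq'.stay j hj⟩

end ChainShift

section PathMetric

variable {n : ℕ} {X : Set (Loc n)}

theorem pathEDist_self {p : Loc n} (hp : p ∈ X) : pathEDist X p p = 0 := by
  refine le_antisymm ?_ bot_le
  refine (iInf₂_le (fun _ => p) ⟨continuousOn_const, fun _ _ => hp, rfl, rfl⟩).trans_eq ?_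
  exact eVariationOn.constant_on
    (subsingleton_singleton.anti (image_subset_iff.2 fun _ _ => mem_singleton p))

theorem pathEDist_comm (p q : Loc n) : pathEDist X p q = pathEDist X q p := by
  suffices h : ∀ p q, pathEDist X p q ≤ pathEDist X q p from (h p q).antisymm (h q p)
  refine fun p q => le_iInf₂ fun γ ⟨γ_cont, γ_mem, γ_zero, γ_one⟩ => ?_
  have reflect : MapsTo (fun t : ℝ => 1 - t) (Icc 0 1) (Icc 0 1) := fun t ht =>
    ⟨sub_nonneg.2 ht.2, sub_le_self 1 ht.1⟩
  refine (iInf₂_le (γ ∘ fun t => 1 - t) ⟨γ_cont.comp (by fun_prop) reflect, γ_mem.comp reflect,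
    by simp [γ_one], by simp [γ_zero]⟩).trans ?_
  exact eVariationOn.comp_le_of_antitoneOn γ _ (fun _ _ _ _ hst => sub_le_sub_left hst 1) reflect

theorem pathEDist_le_eVariationOn {γ : ℝ → Loc n} {a b : ℝ} (hab : a ≤ b)
    (hγ : ContinuousOn γ (Icc a b)) (hγX : MapsTo γ (Icc a b) X) :
    pathEDist X (γ a) (γ b) ≤ eVariationOn γ (Icc a b) := by
  have rescale : MapsTo (AffineMap.lineMap a b : ℝ → ℝ) (Icc 0 1) (Icc a b) := fun t ht =>
    (convex_Icc a b).lineMap_mem (left_mem_Icc.2 hab) (right_mem_Icc.2 hab) ht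
  refine (iInf₂_le (γ ∘ AffineMap.lineMap a b) ⟨hγ.comp (by fun_prop) rescale, hγX.comp rescale,
    by simp, by simp⟩).trans ?_
  exact eVariationOn.comp_le_of_monotoneOn γ _ ((AffineMap.lineMap_mono hab).monotoneOn _) rescale

theorem pathEDist_triangle (p q r : Loc n) :
    pathEDist X p r ≤ pathEDist X p q + pathEDist X q r := by
  conv_rhs => simp only [pathEDist, ENNReal.iInf_add, ENNReal.add_iInf]
  refine le_iInf₂ fun γ₂ ⟨cont₂, mem₂, zero₂, one₂⟩ =>
    le_iInf₂ fun γ₁ ⟨cont₁, mem₁, zero₁, one₁⟩ => ?_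
  let γ : ℝ → Loc n := fun t => if t ≤ 1 then γ₁ t else γ₂ (t - 1)
  have eqOn₁ : EqOn γ γ₁ (Icc 0 1) := fun t ht => if_pos ht.2
  have eqOn₂ : EqOn γ (γ₂ ∘ fun t => t - 1) (Icc 1 2) := fun t ht => by
    obtain rfl | h := ht.1.eq_or_lt
    · simp [γ, one₁, zero₂]
    · simp [γ, not_le.2 h]
  have shift : MapsTo (fun t : ℝ => t - 1) (Icc 1 2) (Icc 0 1) := fun t ht =>
    ⟨by linarith [ht.1], by linarith [ht.2]⟩
  have Icc_eq : Icc (0 : ℝ) 2 = Icc 0 1 ∪ Icc 1 2 :=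
    (Icc_union_Icc_eq_Icc zero_le_one one_le_two).symm
  have γ_cont : ContinuousOn γ (Icc 0 2) := by
    rw [Icc_eq]
    exact (cont₁.congr eqOn₁).union_of_isClosed ((cont₂.comp (by fun_prop) shift).congr eqOn₂)
      isClosed_Icc isClosed_Icc
  have γ_mem : MapsTo γ (Icc 0 2) X := by
    rw [Icc_eq]
    exact (mem₁.congr eqOn₁.symm).union ((mem₂.comp shift).congr eqOn₂.symm)
  calc pathEDist X p r = pathEDist X (γ 0) (γ 2) := by
        rw [eqOn₁ (left_mem_Icc.2 zero_le_one), eqOn₂ (right_mem_Icc.2 one_le_two), zero₁,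
          comp_apply, show (2 : ℝ) - 1 = 1 by norm_num, one₂]
    _ ≤ eVariationOn γ (Icc 0 2) := pathEDist_le_eVariationOn zero_le_two γ_cont γ_mem
    _ = eVariationOn γ₁ (Icc 0 1) + eVariationOn (γ₂ ∘ fun t => t - 1) (Icc 1 2) := by
        rw [Icc_eq, eVariationOn.union γ (isGreatest_Icc zero_le_one) (isLeast_Icc one_le_two),
          eVariationOn.congr eqOn₁, eVariationOn.congr eqOn₂]
    _ ≤ eVariationOn γ₁ (Icc 0 1) + eVariationOn γ₂ (Icc 0 1) := by
        gcongr
        exact eVariationOn.comp_le_of_monotoneOn γ₂ _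
          (fun _ _ _ _ hst => sub_le_sub_right hst 1) shift

theorem exists_crossing {E : Type*} [PseudoEMetricSpace E] {γ : ℝ → E} {a b : ℝ} (hab : a ≤ b)
    (hγ : ContinuousOn γ (Icc a b)) (hγ' : BoundedVariationOn γ (Icc a b)) {U : Set E}
    (ha : γ a ∈ U) (hb : γ b ∉ U) {ε : ℝ≥0∞} (hε : 0 < ε) :
    ∃ s t, a ≤ s ∧ s ≤ t ∧ t ≤ b ∧ eVariationOn γ (Icc s t) < ε ∧ γ s ∈ U ∧ γ t ∉ U := by
  let T : Set ℝ := {t ∈ Icc a b | γ t ∈ U}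
  have T_nonempty : T.Nonempty := ⟨a, left_mem_Icc.2 hab, ha⟩
  have T_bddAbove : BddAbove T := ⟨b, fun t ht => ht.1.2⟩
  have lub : IsLUB T (sSup T) := isLUB_csSup T_nonempty T_bddAbove
  set x := sSup T
  have hax : a ≤ x := lub.1 ⟨left_mem_Icc.2 hab, ha⟩
  have hxb : x ≤ b := lub.2 fun t ht => ht.1.2
  by_cases hxU : γ x ∈ U
  · have hlt : x < b := hxb.lt_of_ne fun h => hb (h ▸ hxU)
    have small := (hγ'.tendsto_eVariationOn_Icc_zero_right x
      ((hγ x ⟨hax, hxb⟩).mono inter_subset_left)).eventually (gt_mem_nhds hε)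
    have := left_nhdsWithin_Ioc_neBot hlt
    obtain ⟨t, htε, ht⟩ := ((small.filter_mono (nhdsWithin_mono x
      (Ioc_subset_Icc_self.trans (Icc_subset_Icc_left hax)))).and self_mem_nhdsWithin).exists
    rw [inter_eq_self_of_subset_right (Icc_subset_Icc hax ht.2)] at htε
    exact ⟨x, t, hax, ht.1.le, ht.2, htε, hxU, fun htU =>
      ht.1.not_ge (lub.1 ⟨⟨hax.trans ht.1.le, ht.2⟩, htU⟩)⟩
  · have small := (hγ'.tendsto_eVariationOn_Icc_zero_left
      ((hγ x ⟨hax, hxb⟩).mono inter_subset_left)).eventually (gt_mem_nhds hε)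
    have := lub.nhdsWithin_neBot T_nonempty
    obtain ⟨s, hsε, hs⟩ := ((small.filter_mono
      (nhdsWithin_mono x (sep_subset _ fun t => γ t ∈ U))).and self_mem_nhdsWithin).exists
    rw [inter_eq_self_of_subset_right (Icc_subset_Icc hs.1.1 hxb)] at hsε
    exact ⟨s, x, hs.1.1, lub.1 hs, hxb, hsε, hs.2, hxU⟩

end PathMetric

theorem eventually_le_of_le_add_two_mul (x y : ℝ≥0) :
    ∀ᶠ ε in 𝓝[>] (0 : ℝ≥0), x ≤ y + 2 * ε → x ≤ y := by
  obtain h | h := le_or_gt x y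
  · exact .of_forall fun _ _ => h
  · have lim : Tendsto (fun ε => y + 2 * ε) (𝓝[>] (0 : ℝ≥0)) (𝓝 y) := by
      have : Continuous fun ε : ℝ≥0 => y + 2 * ε := by fun_prop
      simpa using (this.tendsto 0).mono_left nhdsWithin_le_nhds
    filter_upwards [lim.eventually_lt_const h] with ε hε hle using absurd hle hε.not_ge

namespace Problem

variable {n m : ℕ} (P : Problem n)

theorem coe_dist {p q : Loc n} (hp : p ∈ P.X) (hq : q ∈ P.X) :
    (P.dist p q : ℝ≥0∞) = pathEDist P.X p q :=
  ENNReal.coe_toNNReal (P.connected p hp q hq)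

theorem dist_self {p : Loc n} (hp : p ∈ P.X) : P.dist p p = 0 := by
  simp [dist, pathEDist_self hp]

theorem dist_comm (p q : Loc n) : P.dist p q = P.dist q p := by
  rw [dist, dist, pathEDist_comm]

theorem dist_triangle {p q r : Loc n} (hp : p ∈ P.X) (hq : q ∈ P.X) (hr : r ∈ P.X) :
    P.dist p r ≤ P.dist p q + P.dist q r := by
  rw [← ENNReal.coe_le_coe, ENNReal.coe_add, P.coe_dist hp hr, P.coe_dist hp hq, P.coe_dist hq hr]
  exact pathEDist_triangle p q r

theorem f_dist_triangle {p q r : Loc n} (hp : p ∈ P.X) (hq : q ∈ P.X) (hr : r ∈ P.X) :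
    P.f (P.dist p r) ≤ P.f (P.dist p q) + P.f (P.dist q r) :=
  (P.strictMono_f.monotone (P.dist_triangle hp hq hr)).trans (P.subadditive_f _ _)

theorem exists_step_out {p q : Loc n} (hp : p ∈ P.X) (hq : q ∈ P.X) {U : Set (Loc n)}
    (hpU : p ∈ U) (hqU : q ∉ U) {ε : ℝ≥0} (hε : 0 < ε) :
    ∃ a ∈ P.X, ∃ b ∈ P.X, a ∈ U ∧ b ∉ U ∧ P.dist a b ≤ ε ∧
      P.dist p a + P.dist b q ≤ P.dist p q + ε := by
  have hlt : pathEDist P.X p q < P.dist p q + ε := by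
    rw [P.coe_dist hp hq]
    exact ENNReal.lt_add_right (P.connected p hp q hq) (by simpa using hε.ne')
  simp only [pathEDist, iInf_lt_iff] at hlt
  obtain ⟨γ, ⟨hγ, hγX, rfl, rfl⟩, length_lt⟩ := hlt
  have hγ' : BoundedVariationOn γ (Icc 0 1) := (length_lt.trans (by finiteness)).ne
  obtain ⟨s, t, hs, hst, ht, small, hsU, htU⟩ :=
    exists_crossing zero_le_one hγ hγ' hpU hqU (ENNReal.coe_pos.2 hε)
  have hsX : γ s ∈ P.X := hγX ⟨hs, hst.trans ht⟩
  have htX : γ t ∈ P.X := hγX ⟨hs.trans hst, ht⟩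
  have dist_le {x y : ℝ} (hx : 0 ≤ x) (hxy : x ≤ y) (hy : y ≤ 1) :
      (P.dist (γ x) (γ y) : ℝ≥0∞) ≤ eVariationOn γ (Icc x y) := by
    have sub := Icc_subset_Icc hx hy
    rw [P.coe_dist (hγX (sub (left_mem_Icc.2 hxy))) (hγX (sub (right_mem_Icc.2 hxy)))]
    exact pathEDist_le_eVariationOn hxy (hγ.mono sub) (hγX.mono_left sub)
  refine ⟨γ s, hsX, γ t, htX, hsU, htU,
    ENNReal.coe_le_coe.1 ((dist_le hs hst ht).trans small.le), ?_⟩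
  rw [← ENNReal.coe_le_coe, ENNReal.coe_add, ENNReal.coe_add]
  calc (P.dist (γ 0) (γ s) + P.dist (γ t) (γ 1) : ℝ≥0∞)
      ≤ eVariationOn γ (Icc 0 s) + eVariationOn γ (Icc t 1) :=
        add_le_add (dist_le le_rfl hs (hst.trans ht)) (dist_le (hs.trans hst) ht le_rfl)
    _ ≤ eVariationOn γ (Icc 0 s ∪ Icc t 1) :=
        eVariationOn.add_le_union γ fun x hx y hy => hx.2.trans (hst.trans hy.1)
    _ ≤ eVariationOn γ (Icc 0 1) := eVariationOn.mono γ
        (union_subset (Icc_subset_Icc_right (hst.trans ht)) (Icc_subset_Icc_left (hs.trans hst)))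
    _ ≤ P.dist (γ 0) (γ 1) + ε := length_lt.le

/-- The path distance is bounded on the environment. Without this the supremum in
`Problem.radius` may be the junk value `0`. -/
def HasFiniteDiameter : Prop := ∃ B, ∀ p ∈ P.X, ∀ q ∈ P.X, P.dist p q ≤ B

section Neighbors

variable {P} {Q : Fin m → Loc n} {i j k : Fin m} {u v a b p : Loc n}

theorem mem_neighbors :
    j ∈ P.neighbors Q i ↔ P.dist (Q i) (Q j) ≤ 4 * max (P.radius Q i) (P.radius Q j) := by
  simp [neighbors]

theorem mem_neighbors_comm : j ∈ P.neighbors Q i ↔ i ∈ P.neighbors Q j := by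
  rw [mem_neighbors, mem_neighbors, max_comm, P.dist_comm]

theorem exists_mem_voronoi [Nonempty (Fin m)] (Q : Fin m → Loc n) (hp : p ∈ P.X) :
    ∃ i, p ∈ P.voronoi Q i :=
  let ⟨i, hi⟩ := Finite.exists_min fun i => P.dist p (Q i)
  ⟨i, hp, hi⟩

variable (hQ : ∀ i, Q i ∈ P.X)
include hQ

theorem self_mem_voronoi (i : Fin m) : Q i ∈ P.voronoi Q i :=
  ⟨hQ i, fun j => by rw [P.dist_self (hQ i)]; exact zero_le⟩

variable (hP : P.HasFiniteDiameter)
include hP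

theorem dist_le_radius (hp : p ∈ P.voronoi Q i) : P.dist p (Q i) ≤ P.radius Q i := by
  obtain ⟨B, hB⟩ := hP
  refine le_csSup ⟨B, ?_⟩ (mem_image_of_mem _ hp)
  rintro _ ⟨x, hx, rfl⟩
  exact hB x hx.1 _ (hQ i)

theorem dist_le_of_mem_voronoi (ha : a ∈ P.voronoi Q i) (hb : b ∈ P.voronoi Q j) :
    P.dist (Q i) (Q j) ≤ P.dist a b + 2 * max (P.radius Q i) (P.radius Q j) := by
  have := dist_le_radius hQ hP ha
  have := dist_le_radius hQ hP hb
  have := P.dist_triangle (hQ i) ha.1 (hQ j)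
  have := P.dist_triangle ha.1 hb.1 (hQ j)
  have := P.dist_comm a (Q i)
  have := le_max_left (P.radius Q i) (P.radius Q j)
  have := le_max_right (P.radius Q i) (P.radius Q j)
  linarith

theorem mem_neighbors_of_dist_le (ha : a ∈ P.voronoi Q i) (hb : b ∈ P.voronoi Q j)
    (hab : P.dist a b ≤ 2 * max (P.radius Q i) (P.radius Q j)) : j ∈ P.neighbors Q i := by
  rw [mem_neighbors]
  linarith [dist_le_of_mem_voronoi hQ hP ha hb]

theorem mem_neighbors_of_mem_voronoi (hi : p ∈ P.voronoi Q i) (hj : p ∈ P.voronoi Q j) :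
    j ∈ P.neighbors Q i :=
  mem_neighbors_of_dist_le hQ hP hi hj (by rw [P.dist_self hi.1]; exact zero_le)

theorem mem_neighbors_of_closer (hv : v ∈ P.voronoi Q i) (hu : u ∈ P.voronoi Q j)
    (h : P.dist u v ≤ P.dist u (Q j)) : j ∈ P.neighbors Q i := by
  refine mem_neighbors_of_dist_le hQ hP hv hu ?_
  have := dist_le_radius hQ hP hu
  have := P.dist_comm u v
  have := le_max_right (P.radius Q i) (P.radius Q j)
  linarith

theorem eventually_mem_neighbors : ∀ᶠ ε in 𝓝[>] (0 : ℝ≥0), ∀ i j,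
    ∀ a ∈ P.voronoi Q i, ∀ b ∈ P.voronoi Q j,
      P.dist a b ≤ 2 * max (P.radius Q i) (P.radius Q j) + 2 * ε → j ∈ P.neighbors Q i := by
  have cancel : ∀ᶠ ε in 𝓝[>] (0 : ℝ≥0), ∀ i j,
      P.dist (Q i) (Q j) ≤ 4 * max (P.radius Q i) (P.radius Q j) + 2 * ε →
        P.dist (Q i) (Q j) ≤ 4 * max (P.radius Q i) (P.radius Q j) :=
    eventually_all.2 fun _ => eventually_all.2 fun _ => eventually_le_of_le_add_two_mul _ _
  filter_upwards [cancel] with ε cancel i j a ha b hb hab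
  rw [mem_neighbors]
  apply cancel
  linarith [dist_le_of_mem_voronoi hQ hP ha hb]

theorem exists_neighbor_closer (hu : u ∈ P.voronoi Q k) (hv : v ∈ P.voronoi Q i)
    (hik : i ∉ P.neighbors Q k) :
    ∃ l ∈ P.neighbors Q k, l ≠ k ∧ P.dist u (Q l) ≤ P.dist u v := by
  have : Nonempty (Fin m) := ⟨i⟩
  have hvk : v ∉ P.voronoi Q k := fun h => hik (mem_neighbors_of_mem_voronoi hQ hP h hv)
  have cancel : ∀ᶠ ε in 𝓝[>] (0 : ℝ≥0), ∀ l, P.dist u (Q l) ≤ P.dist u v + 2 * ε →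
      P.dist u (Q l) ≤ P.dist u v := eventually_all.2 fun l => eventually_le_of_le_add_two_mul _ _
  obtain ⟨ε, ⟨near, cancel⟩, ε_pos⟩ :=
    (((eventually_mem_neighbors hQ hP).and cancel).and self_mem_nhdsWithin).exists
  obtain ⟨a, ha, b, hb, hak, hbk, hab, hpath⟩ := P.exists_step_out hu.1 hv.1 hu hvk ε_pos
  obtain ⟨l, hl⟩ := exists_mem_voronoi Q hb
  refine ⟨l, near k l a hak b hl (le_add_left (by linarith)), fun hlk => hbk (hlk ▸ hl),
    cancel l ?_⟩
  have closer : P.dist b (Q l) ≤ P.dist b v := by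
    -- Otherwise `v` would be so close to `b`, hence to the cell of `k`, that `i` is a neighbour.
    by_contra! h
    refine hik (near k i a hak v hv ?_)
    have := hl.2 k
    have := P.dist_triangle ha hb hv.1
    have := P.dist_triangle hb ha (hQ k)
    have := P.dist_comm a b
    have := dist_le_radius hQ hP hak
    have := le_max_left (P.radius Q k) (P.radius Q i)
    linarith
  have := P.dist_triangle hu.1 ha (hQ l)
  have := P.dist_triangle ha hb (hQ l)
  linarith

theorem reflTransGen_neighbors (i k : Fin m) :
    Relation.ReflTransGen (fun a b => b ∈ P.neighbors Q a) i k := by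
  by_contra hk
  have : Nonempty (Fin m) := ⟨i⟩
  let U : Set (Loc n) :=
    {p | ∃ l, Relation.ReflTransGen (fun a b => b ∈ P.neighbors Q a) i l ∧ p ∈ P.voronoi Q l}
  have hiU : Q i ∈ U := ⟨i, .refl, self_mem_voronoi hQ i⟩
  have hkU : Q k ∉ U := fun ⟨l, hl, hkl⟩ =>
    hk (hl.tail (mem_neighbors_of_mem_voronoi hQ hP hkl (self_mem_voronoi hQ k)))
  obtain ⟨ε, near, ε_pos⟩ := ((eventually_mem_neighbors hQ hP).and self_mem_nhdsWithin).exists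
  obtain ⟨a, -, b, hb, ⟨j, hij, haj⟩, hbU, hab, -⟩ :=
    P.exists_step_out (hQ i) (hQ k) hiU hkU ε_pos
  obtain ⟨l, hbl⟩ := exists_mem_voronoi Q hb
  exact hbU ⟨l, hij.tail (near j l a haj b hbl (le_add_left (by linarith))), hbl⟩

end Neighbors

end Problem

namespace Problem.Sampling

variable {n m : ℕ} {P : Problem n} (𝒮 : P.Sampling)

theorem mem_X (u : 𝒮.V) : (u : Loc n) ∈ P.X := 𝒮.subset_X u u.2

theorem loc_mem_X (q : 𝒮.Config m) (i : Fin m) : 𝒮.loc q i ∈ P.X := 𝒮.mem_X (q i)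

theorem dist_near_le_dispersion {ζ : ℝ≥0} (hζ : 𝒮.IsDispersion ζ) {p : Loc n} (hp : p ∈ P.X) :
    P.dist p (𝒮.near p) ≤ ζ := by
  have : Nonempty 𝒮.V := ⟨𝒮.near p⟩
  exact (le_ciInf fun u : 𝒮.V => 𝒮.dist_near_le p hp u u.2).trans (hζ.1 (mem_image_of_mem _ hp))

theorem hasFiniteDiameter {ζ : ℝ≥0} (hζ : 𝒮.IsDispersion ζ) : P.HasFiniteDiameter := by
  obtain ⟨b, hb⟩ := (finite_range fun x : 𝒮.V × 𝒮.V => P.dist x.1 x.2).bddAbove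
  refine ⟨ζ + b + ζ, fun p hp q hq => ?_⟩
  have := P.dist_triangle hp (𝒮.mem_X (𝒮.near p)) hq
  have := P.dist_triangle (𝒮.mem_X (𝒮.near p)) (𝒮.mem_X (𝒮.near q)) hq
  have : P.dist (𝒮.near p) (𝒮.near q) ≤ b := hb ⟨(𝒮.near p, 𝒮.near q), rfl⟩
  have := 𝒮.dist_near_le_dispersion hζ hp
  have := 𝒮.dist_near_le_dispersion hζ hq
  have := P.dist_comm q (𝒮.near q)
  linarith

theorem c_nonneg (u v : 𝒮.V) : 0 ≤ 𝒮.c u v := NNReal.coe_nonneg _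

theorem c_comm (u v : 𝒮.V) : 𝒮.c u v = 𝒮.c v u := by rw [c, c, P.dist_comm]

theorem c_triangle (u v x : 𝒮.V) : 𝒮.c u x ≤ 𝒮.c u v + 𝒮.c v x :=
  mod_cast P.f_dist_triangle (𝒮.mem_X u) (𝒮.mem_X v) (𝒮.mem_X x)

theorem c_le_c_iff {u v x y : 𝒮.V} : 𝒮.c u v ≤ 𝒮.c x y ↔ P.dist u v ≤ P.dist x y := by
  rw [c, c, NNReal.coe_le_coe, P.strictMono_f.le_iff_le]

theorem w_nonneg (u : 𝒮.V) : 0 ≤ 𝒮.w u := ENNReal.toReal_nonneg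

theorem minCost_eq_iInf {κ : Type*} [Finite κ] [Nonempty κ] {u : 𝒮.V} {T : Set 𝒮.V}
    {q : κ → 𝒮.V} (hT : T ⊆ range q) (h : ∀ i, ∃ x ∈ T, 𝒮.c u x ≤ 𝒮.c u (q i)) :
    𝒮.minCost u T = ⨅ i, 𝒮.c u (q i) := by
  apply le_antisymm
  · refine le_ciInf fun i => ?_
    obtain ⟨x, hx, hxi⟩ := h i
    exact (csInf_le ((toFinite T).image _).bddBelow (mem_image_of_mem _ hx)).trans hxi
  · obtain ⟨x, hx, -⟩ := h (Classical.arbitrary κ)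
    refine le_csInf ⟨_, mem_image_of_mem _ hx⟩ (forall_mem_image.2 fun x hx => ?_)
    obtain ⟨i, rfl⟩ := hT hx
    exact ciInf_le (finite_range _).bddBelow i

/-- The cost of a configuration on the graph of the samples. It is the discrete counterpart of
`Problem.cost`, and the potential function of the algorithm. -/
def graphCost (q : 𝒮.Config m) : ℝ := medianCost Finset.univ 𝒮.w 𝒮.c q

variable {𝒮}

section Parts

variable {q : 𝒮.Config m} {i j k : Fin m} {u v : 𝒮.V}

theorem mem_part_iff_forall_toLex_le :
    u ∈ 𝒮.part q i ↔ ∀ j, toLex (𝒮.c u (q i), i) ≤ toLex (𝒮.c u (q j), j) := by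
  simp only [part, Finset.mem_filter_univ, Prod.Lex.toLex_le_toLex]
  refine forall_congr' fun j => ?_
  obtain rfl | hj := eq_or_ne j i
  · simp
  · simp only [ne_eq, hj, not_false_eq_true, forall_const, hj.symm.le_iff_lt]

theorem c_le_of_mem_part (h : u ∈ 𝒮.part q i) (j : Fin m) : 𝒮.c u (q i) ≤ 𝒮.c u (q j) :=
  (Prod.Lex.toLex_le_toLex'.1 (mem_part_iff_forall_toLex_le.1 h j)).1

theorem mem_voronoi_of_mem_part (h : u ∈ 𝒮.part q i) : (u : Loc n) ∈ P.voronoi (𝒮.loc q) i :=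
  ⟨𝒮.mem_X u, fun j => 𝒮.c_le_c_iff.1 (c_le_of_mem_part h j)⟩

theorem existsUnique_mem_part [Nonempty (Fin m)] (q : 𝒮.Config m) (u : 𝒮.V) :
    ∃! i, u ∈ 𝒮.part q i := by
  obtain ⟨i, hi⟩ := Finite.exists_min fun i => toLex (𝒮.c u (q i), i)
  refine ⟨i, mem_part_iff_forall_toLex_le.2 hi, fun j hj => ?_⟩
  exact congrArg (fun x => (ofLex x).2) ((mem_part_iff_forall_toLex_le.1 hj i).antisymm (hi j))

theorem sum_part [Nonempty (Fin m)] (q : 𝒮.Config m) (F : 𝒮.V → ℝ) :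
    ∑ u, F u = ∑ j, ∑ u ∈ 𝒮.part q j, F u := by
  classical
  choose owner mem_owner owner_unique using existsUnique_mem_part q
  have part_eq (j : Fin m) : 𝒮.part q j = Finset.univ.filter fun u => owner u = j := by
    ext u
    rw [Finset.mem_filter_univ]
    exact ⟨fun hj => (owner_unique u j hj).symm, fun hj => hj ▸ mem_owner u⟩
  simp only [part_eq, Finset.sum_fiberwise]

theorem iInf_c_eq_of_mem_part (hu : u ∈ 𝒮.part q j) : ⨅ i, 𝒮.c u (q i) = 𝒮.c u (q j) :=
  have : Nonempty (Fin m) := ⟨j⟩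
  (ciInf_le (finite_range _).bddBelow j).antisymm (le_ciInf (c_le_of_mem_part hu))

theorem iInf_c_update_of_ne (hu : u ∈ 𝒮.part q j) (hjk : j ≠ k) (v : 𝒮.V) :
    ⨅ i, 𝒮.c u (update q k v i) = min (𝒮.c u v) (𝒮.c u (q j)) := by
  refine eq_of_forall_le_iff fun a => ?_
  rw [le_ciInf_update_iff, le_min_iff]
  exact and_congr_right fun _ =>
    ⟨fun h => h j hjk, fun h l _ => h.trans (c_le_of_mem_part hu l)⟩

theorem graphCost_sub_graphCost [Nonempty (Fin m)] (q' q : 𝒮.Config m) :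
    𝒮.graphCost q' - 𝒮.graphCost q =
      ∑ j, ∑ u ∈ 𝒮.part q j, 𝒮.w u * ((⨅ i, 𝒮.c u (q' i)) - 𝒮.c u (q j)) := by
  rw [graphCost, graphCost, medianCost, medianCost, ← Finset.sum_sub_distrib, sum_part q]
  refine Finset.sum_congr rfl fun j _ => Finset.sum_congr rfl fun u hu => ?_
  rw [iInf_c_eq_of_mem_part hu, mul_sub]

end Parts

section Locality

variable {q : 𝒮.Config m} {i j k l : Fin m} {u v : 𝒮.V}

theorem self_mem_nbr (q : 𝒮.Config m) (i : Fin m) : i ∈ 𝒮.nbr q i := by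
  rw [nbr, mem_neighbors, P.dist_self (𝒮.loc_mem_X q i)]
  exact zero_le

theorem mem_nbr_comm : j ∈ 𝒮.nbr q i ↔ i ∈ 𝒮.nbr q j := mem_neighbors_comm

variable (hP : P.HasFiniteDiameter)
include hP

theorem c_le_of_notMem_nbr (hv : v ∈ 𝒮.part q i) (hu : u ∈ 𝒮.part q j) (hij : j ∉ 𝒮.nbr q i) :
    𝒮.c u (q j) ≤ 𝒮.c u v := by
  contrapose! hij
  exact mem_neighbors_of_closer (𝒮.loc_mem_X q) hP (mem_voronoi_of_mem_part hv)
    (mem_voronoi_of_mem_part hu) (𝒮.c_le_c_iff.1 hij.le)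

theorem exists_mem_others_of_notMem_nbr (hu : u ∈ 𝒮.part q k)
    (hv : (v : Loc n) ∈ P.voronoi (𝒮.loc q) i) (hik : i ∉ 𝒮.nbr q k) :
    ∃ x ∈ 𝒮.others q k, 𝒮.c u x ≤ 𝒮.c u v := by
  obtain ⟨l, hl, hlk, hle⟩ := exists_neighbor_closer (𝒮.loc_mem_X q) hP
    (mem_voronoi_of_mem_part hu) hv hik
  exact ⟨q l, ⟨l, hl, hlk, rfl⟩, 𝒮.c_le_c_iff.2 hle⟩

theorem exists_mem_others (hu : u ∈ 𝒮.part q j) (hj : j ∈ 𝒮.nbr q k) (hl : l ≠ k) :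
    ∃ x ∈ 𝒮.others q k, 𝒮.c u x ≤ 𝒮.c u (q l) := by
  obtain rfl | hjk := eq_or_ne j k
  · by_cases hlj : l ∈ 𝒮.nbr q j
    · exact ⟨q l, ⟨l, hlj, hl, rfl⟩, le_rfl⟩
    · exact exists_mem_others_of_notMem_nbr hP hu (self_mem_voronoi (𝒮.loc_mem_X q) l) hlj
  · exact ⟨q j, ⟨j, hj, hjk, rfl⟩, c_le_of_mem_part hu l⟩

omit hP in
theorem others_subset_range_update (q : 𝒮.Config m) (k : Fin m) (v : 𝒮.V) :
    𝒮.others q k ⊆ range (update q k v) := by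
  rintro _ ⟨j, -, hj, rfl⟩
  exact ⟨j, update_of_ne hj v q⟩

theorem minCost_insert_others (hu : u ∈ 𝒮.part q j) (hj : j ∈ 𝒮.nbr q k) (v : 𝒮.V) :
    𝒮.minCost u (insert v (𝒮.others q k)) = ⨅ l, 𝒮.c u (update q k v l) := by
  have : Nonempty (Fin m) := ⟨j⟩
  refine 𝒮.minCost_eq_iInf (insert_subset ⟨k, update_self k v q⟩
    (others_subset_range_update q k v)) ?_
  rw [forall_update_iff q fun _ y => ∃ x ∈ insert v (𝒮.others q k), 𝒮.c u x ≤ 𝒮.c u y]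
  refine ⟨⟨v, mem_insert v _, le_rfl⟩, fun l hl => ?_⟩
  obtain ⟨x, hx, hle⟩ := exists_mem_others hP hu hj hl
  exact ⟨x, mem_insert_of_mem v hx, hle⟩

theorem delta_eq (hv : v ∈ 𝒮.part q i) :
    𝒮.delta q i v = 𝒮.graphCost (update q i v) - 𝒮.graphCost q := by
  have : Nonempty (Fin m) := ⟨i⟩
  rw [graphCost_sub_graphCost, delta]
  refine (Finset.sum_congr rfl fun j hj => Finset.sum_congr rfl fun u hu => ?_).trans
    (Finset.sum_subset (Finset.subset_univ _) fun j _ hj => Finset.sum_eq_zero fun u hu => ?_)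
  · rw [minCost_insert_others hP hu hj]
  · have hji : j ≠ i := fun h => hj (h ▸ self_mem_nbr q i)
    rw [iInf_c_update_of_ne hu hji, min_eq_right (c_le_of_notMem_nbr hP hv hu hj), sub_self,
      mul_zero]

theorem rho_eq (hv : v ∈ 𝒮.part q i) : 𝒮.rho q i v =
    ∑ j, ∑ u ∈ 𝒮.part q j, 𝒮.w u * (min (𝒮.c u v) (𝒮.c u (q j)) - 𝒮.c u (q j)) := by
  refine (Finset.sum_congr rfl fun j _ => ?_).trans
    (Finset.sum_subset (Finset.subset_univ _) fun j _ hj => Finset.sum_eq_zero fun u hu => ?_)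
  · rw [gained, Finset.sum_filter]
    refine Finset.sum_congr rfl fun u _ => ?_
    split_ifs with h
    · rw [min_eq_left h.le]
    · rw [min_eq_right (not_lt.1 h), sub_self, mul_zero]
  · rw [min_eq_right (c_le_of_notMem_nbr hP hv hu hj), sub_self, mul_zero]

theorem graphCost_update_sub (hv : v ∈ 𝒮.part q i) (k : Fin m) :
    𝒮.graphCost (update q k v) - 𝒮.graphCost q = 𝒮.rho q i v + ∑ u ∈ 𝒮.part q k,
      𝒮.w u * ((⨅ l, 𝒮.c u (update q k v l)) - min (𝒮.c u v) (𝒮.c u (q k))) := by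
  have : Nonempty (Fin m) := ⟨i⟩
  rw [← sub_eq_iff_eq_add', graphCost_sub_graphCost, rho_eq hP hv, ← Finset.sum_sub_distrib]
  simp only [← Finset.sum_sub_distrib, ← mul_sub, sub_sub_sub_cancel_right]
  refine Finset.sum_eq_single k (fun j _ hj => Finset.sum_eq_zero fun u hu => ?_) (by simp)
  rw [iInf_c_update_of_ne hu hj, sub_self, mul_zero]

theorem rho_add_ellNear (hv : v ∈ 𝒮.part q i) (k : Fin m) :
    𝒮.rho q i v + 𝒮.ellNear q k v = 𝒮.graphCost (update q k v) - 𝒮.graphCost q := by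
  classical
  rw [graphCost_update_sub hP hv k, ellNear, gained, ← Finset.filter_not, Finset.sum_filter]
  refine congrArg _ (Finset.sum_congr rfl fun u hu => ?_)
  split_ifs with h
  · have : ⨅ l, 𝒮.c u (update q k v l) = 𝒮.c u v := eq_of_forall_le_iff fun a => by
      rw [le_ciInf_update_iff]
      exact and_iff_left_of_imp fun ha l _ => (ha.trans h.le).trans (c_le_of_mem_part hu l)
    rw [this, min_eq_left h.le, sub_self, mul_zero]
  · rw [minCost_insert_others hP hu (self_mem_nbr q k), min_eq_right (not_lt.1 h)]

theorem rho_add_ellFar (hv : v ∈ 𝒮.part q i) (hk : k ∉ 𝒮.nbr q i) :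
    𝒮.rho q i v + 𝒮.ellFar q k = 𝒮.graphCost (update q k v) - 𝒮.graphCost q := by
  have : Nonempty (Fin m) := ⟨i⟩
  rw [graphCost_update_sub hP hv k, ellFar]
  refine congrArg _ (Finset.sum_congr rfl fun u hu => ?_)
  rw [min_eq_right (c_le_of_notMem_nbr hP hv hu hk),
    𝒮.minCost_eq_iInf (others_subset_range_update q k v)]
  rw [forall_update_iff q fun _ y => ∃ x ∈ 𝒮.others q k, 𝒮.c u x ≤ 𝒮.c u y]
  exact ⟨exists_mem_others_of_notMem_nbr hP hu (mem_voronoi_of_mem_part hv)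
    (mt mem_nbr_comm.1 hk), fun l hl => exists_mem_others hP hu (self_mem_nbr q k) hl⟩

end Locality

section Flood

variable {ε₀ : ℝ≥0} {q : 𝒮.Config m} {i k p : Fin m} {h t : ℕ} {v : 𝒮.V}

theorem reached_zero : 𝒮.Reached ε₀ q i 0 k ↔ k = i := by
  rw [Reached, flood, Finset.mem_singleton]

theorem reached_succ : 𝒮.Reached ε₀ q i (h + 1) k ↔ k ∉ (𝒮.flood ε₀ q i h).2 ∧
    ∃ p, 𝒮.Reached ε₀ q i h p ∧ 𝒮.Forwards ε₀ q i h p ∧ k ∈ 𝒮.nbr q p := by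
  simp [Reached, flood]

theorem mem_flood_snd : k ∈ (𝒮.flood ε₀ q i h).2 ↔ ∃ t ≤ h, 𝒮.Reached ε₀ q i t k := by
  induction h with
  | zero => simp [Reached, flood]
  | succ h ih =>
    have union : k ∈ (𝒮.flood ε₀ q i (h + 1)).2 ↔
        k ∈ (𝒮.flood ε₀ q i h).2 ∨ 𝒮.Reached ε₀ q i (h + 1) k := by
      rw [Reached, flood, Finset.mem_union]
    simp only [union, ih, Nat.le_succ_iff, or_and_right, exists_or, exists_eq_left]

theorem reached_unique (ht : 𝒮.Reached ε₀ q i t k) (hh : 𝒮.Reached ε₀ q i h k) : t = h := by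
  suffices hle : ∀ {t h}, 𝒮.Reached ε₀ q i t k → 𝒮.Reached ε₀ q i h k → h ≤ t from
    (hle hh ht).antisymm (hle ht hh)
  intro t h ht hh
  obtain _ | h := h
  · exact t.zero_le
  · contrapose! ht
    exact fun hr => (reached_succ.1 hh).1 (mem_flood_snd.2 ⟨t, Nat.lt_succ_iff.1 ht, hr⟩)

theorem reached_step (hp : 𝒮.Reached ε₀ q i h p) (hf : 𝒮.Forwards ε₀ q i h p)
    (hk : k ∈ 𝒮.nbr q p) : ∃ t ≤ h + 1, 𝒮.Reached ε₀ q i t k := by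
  by_cases hmem : k ∈ (𝒮.flood ε₀ q i h).2
  · obtain ⟨t, ht, hr⟩ := mem_flood_snd.1 hmem
    exact ⟨t, ht.trans h.le_succ, hr⟩
  · exact ⟨h + 1, le_rfl, reached_succ.2 ⟨hmem, p, hp, hf, hk⟩⟩

theorem notMem_nbr_of_reached (hh : 2 ≤ h) (hr : 𝒮.Reached ε₀ q i h k) : k ∉ 𝒮.nbr q i := by
  intro hk
  obtain ⟨t, ht, hrt⟩ := reached_step (reached_zero.2 rfl) (Or.inl rfl) hk
  have := reached_unique hrt hr
  lia

theorem injOn_of_forall_reached {r : ℕ → Fin m} (hr : ∀ t ≤ h, 𝒮.Reached ε₀ q i t (r t)) :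
    InjOn r (Iic h) :=
  fun s hs t ht heq => reached_unique (hr s hs) (heq ▸ hr t ht)

theorem exists_chain (hr : 𝒮.Reached ε₀ q i h k) :
    ∃ r : ℕ → Fin m, r 0 = i ∧ r h = k ∧ (∀ t ≤ h, 𝒮.Reached ε₀ q i t (r t)) ∧
      ∀ t < h, 𝒮.Forwards ε₀ q i t (r t) ∧ r (t + 1) ∈ 𝒮.nbr q (r t) := by
  induction h generalizing k with
  | zero =>
    obtain rfl := reached_zero.1 hr
    exact ⟨fun _ => k, rfl, rfl, fun t ht => by rwa [Nat.le_zero.1 ht], by simp⟩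
  | succ h ih =>
    obtain ⟨-, p, hp, hf, hk⟩ := reached_succ.1 hr
    obtain ⟨r, rfl, rfl, reached, parent⟩ := ih hp
    have old {t : ℕ} (ht : t ≤ h) : update r (h + 1) k t = r t := update_of_ne (by lia) _ _
    refine ⟨update r (h + 1) k, old h.zero_le, update_self _ _ _, fun t ht => ?_, fun t ht => ?_⟩
    · obtain ht | rfl := Nat.le_succ_iff.1 ht
      · exact (old ht).symm ▸ reached t ht
      · rwa [update_self]
    · rw [old (Nat.lt_succ_iff.1 ht)]
      obtain ht | rfl := (Nat.lt_succ_iff.1 ht).lt_or_eq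
      · rw [old ht]
        exact parent t ht
      · rw [update_self]
        exact ⟨hf, hk⟩

theorem exists_reached (hP : P.HasFiniteDiameter)
    (hacc : ∀ h k, 1 ≤ h → 𝒮.Reached ε₀ q i h k → ¬ 𝒮.Accepts ε₀ q i h k) (k : Fin m) :
    ∃ h, 𝒮.Reached ε₀ q i h k := by
  induction reflTransGen_neighbors (𝒮.loc_mem_X q) hP i k with
  | refl => exact ⟨0, reached_zero.2 rfl⟩
  | tail _ hk ih =>
    obtain ⟨h, hp⟩ := ih
    have forwards := h.eq_zero_or_pos.imp_right fun hh => hacc h _ hh hp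
    obtain ⟨t, -, ht⟩ := reached_step hp forwards hk
    exact ⟨t, ht⟩

theorem value_eq (hP : P.HasFiniteDiameter) (hv : v ∈ 𝒮.part q i) (hh : 1 ≤ h)
    (hr : 𝒮.Reached ε₀ q i h k) :
    𝒮.value q i h k v = 𝒮.graphCost (update q k v) - 𝒮.graphCost q := by
  rw [value]
  split_ifs with h_one
  · exact rho_add_ellNear hP hv k
  · exact rho_add_ellFar hP hv (notMem_nbr_of_reached (by lia) hr)

end Flood

section LocalMove

variable {ε₀ : ℝ≥0} {q q' : 𝒮.Config m} {i k : Fin m} {v : 𝒮.V}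

theorem graphCost_eq_of_range_eq (h : range q = range q') : 𝒮.graphCost q = 𝒮.graphCost q' := by
  refine Finset.sum_congr rfl fun u _ => ?_
  rw [iInf, iInf, range_comp' (𝒮.c u), h, ← range_comp']

variable (hP : P.HasFiniteDiameter)
include hP

theorem graphCost_le_of_localMove (hmove : 𝒮.LocalMove ε₀ i q q') :
    𝒮.graphCost q' ≤ 𝒮.graphCost q - ε₀ := by
  obtain ⟨v, hv, improves, -, rfl⟩ |
    ⟨-, h, hpos, r, rfl, reached, -, v, hv, improves, -, start, chain, stay⟩ := hmove
  · rw [delta_eq hP hv] at improves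
    linarith
  · have shift : IsChainShift q q' r h v := ⟨start, chain, stay⟩
    rw [graphCost_eq_of_range_eq (shift.range_eq (injOn_of_forall_reached reached))]
    rw [value_eq hP hv hpos (reached h le_rfl)] at improves
    linarith

omit hP in
theorem exists_localMove_of_delta_le (hv : v ∈ 𝒮.part q i) (h : 𝒮.delta q i v ≤ -ε₀) :
    ∃ q', 𝒮.LocalMove ε₀ i q q' := by
  obtain ⟨x, hx, best⟩ := Finset.exists_min_image (𝒮.part q i) (𝒮.delta q i) ⟨v, hv⟩
  exact ⟨_, .single x hx ((best v hv).trans h) best rfl⟩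

theorem exists_localMove_of_accepts {h : ℕ} (hh : 1 ≤ h) (hr : 𝒮.Reached ε₀ q i h k)
    (hacc : 𝒮.Accepts ε₀ q i h k) : ∃ q', 𝒮.LocalMove ε₀ i q q' := by
  by_cases hsingle : ∃ v ∈ 𝒮.part q i, 𝒮.delta q i v ≤ -ε₀
  · obtain ⟨v, hv, hle⟩ := hsingle
    exact exists_localMove_of_delta_le hv hle
  obtain ⟨v, hv, improves⟩ := hacc
  let candidates : Set (Fin m × 𝒮.V) :=
    {y | (∃ h, 1 ≤ h ∧ 𝒮.Reached ε₀ q i h y.1) ∧ y.2 ∈ 𝒮.part q i}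
  obtain ⟨⟨k', v'⟩, ⟨⟨h', hh', hr'⟩, hv'⟩, best⟩ := exists_min_image candidates
    (fun y => 𝒮.graphCost (update q y.1 y.2)) (toFinite _) ⟨(k, v), ⟨h, hh, hr⟩, hv⟩
  have best {h'' k'' v''} (hh'' : 1 ≤ h'') (hr'' : 𝒮.Reached ε₀ q i h'' k'')
      (hv'' : v'' ∈ 𝒮.part q i) : 𝒮.value q i h' k' v' ≤ 𝒮.value q i h'' k'' v'' := by
    rw [value_eq hP hv' hh' hr', value_eq hP hv'' hh'' hr'']
    exact sub_le_sub_right (best (k'', v'') ⟨⟨h'', hh'', hr''⟩, hv''⟩) _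
  obtain ⟨r, start, rfl, reached, parent⟩ := exists_chain hr'
  obtain ⟨q', shift⟩ := exists_isChainShift q (injOn_of_forall_reached reached) v'
  exact ⟨q', .chain (fun x hx hle => hsingle ⟨x, hx, hle⟩) h' hh' r start reached parent v' hv'
    ((best hh hr hv).trans improves) (fun h'' k'' hh'' hr'' v'' hv'' => best hh'' hr'' hv'')
    (start ▸ shift.start) shift.chain shift.stay⟩

theorem exists_localMove (hv : v ∈ 𝒮.part q i)
    (h : 𝒮.graphCost (update q k v) ≤ 𝒮.graphCost q - ε₀) : ∃ q', 𝒮.LocalMove ε₀ i q q' := by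
  by_cases hacc : ∃ h k, 1 ≤ h ∧ 𝒮.Reached ε₀ q i h k ∧ 𝒮.Accepts ε₀ q i h k
  · obtain ⟨h, k, hh, hr, hacc⟩ := hacc
    exact exists_localMove_of_accepts hP hh hr hacc
  push Not at hacc
  obtain ⟨_ | t, hr⟩ := exists_reached hP hacc k
  · obtain rfl := reached_zero.1 hr
    exact exists_localMove_of_delta_le hv (by rw [delta_eq hP hv]; linarith)
  · have improves : 𝒮.value q i (t + 1) k v ≤ -ε₀ := by
      rw [value_eq hP hv t.succ_pos hr]
      linarith
    exact absurd ⟨v, hv, improves⟩ (hacc (t + 1) k t.succ_pos hr)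

end LocalMove

section Execution

open Relation

variable {ε₀ : ℝ≥0} {q q' : 𝒮.Config m} {i : Fin m}

/-- Robot `i` has no reason to leave its position in `q`: if it takes a turn, the configuration does
not change. -/
def Settled (ε₀ : ℝ≥0) (q : 𝒮.Config m) (i : Fin m) : Prop :=
  0 < ∑ u ∈ 𝒮.part q i, 𝒮.c u (q i) → ∀ q', ¬ 𝒮.LocalMove ε₀ i q q'

theorem settled_of_turn {s s' : 𝒮.State m} (hturn : 𝒮.Turn ε₀ s s')
    (hs : ∀ i ∉ s.2, Settled ε₀ s.1 i) : ∀ i ∉ s'.2, Settled ε₀ s'.1 i := by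
  intro j hj
  obtain ⟨q, A, i, -, guard⟩ | ⟨q, A, i, -, -, done⟩ | ⟨q, q', A, i, -, -, -, done⟩ := hturn
  all_goals
    rw [Finset.mem_erase, not_and_or, not_ne_iff] at hj
    obtain rfl | hj := hj
  · exact fun pos => absurd pos guard
  · exact hs j hj
  · exact fun _ => done
  · exact hs j hj
  · exact fun _ => done
  · exact absurd (Finset.mem_univ j) hj

theorem settled_of_returns {q₀ : 𝒮.Config m} (hret : 𝒮.Returns ε₀ q₀ q) (i : Fin m) :
    Settled ε₀ q i := by
  suffices ∀ s, ReflTransGen (𝒮.Turn ε₀) (q₀, Finset.univ) s → ∀ i ∉ s.2, Settled ε₀ s.1 i from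
    this _ hret i (Finset.notMem_empty i)
  intro s hs
  induction hs with
  | refl => exact fun i hi => absurd (Finset.mem_univ i) hi
  | tail _ hturn ih => exact settled_of_turn hturn ih

theorem graphCost_le_graphCost_update {v : 𝒮.V} (h : 𝒮.c v (q i) = 0) (k : Fin m) :
    𝒮.graphCost q ≤ 𝒮.graphCost (update q k v) := by
  have : Nonempty (Fin m) := ⟨i⟩
  refine Finset.sum_le_sum fun u _ => mul_le_mul_of_nonneg_left ?_ (𝒮.w_nonneg u)
  have bdd := (Set.finite_range fun l => 𝒮.c u (q l)).bddBelow
  refine (le_ciInf_update_iff).2 ⟨(ciInf_le bdd i).trans ?_, fun j _ => ciInf_le bdd j⟩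
  simpa only [h, add_zero] using 𝒮.c_triangle u v (q i)

variable (hP : P.HasFiniteDiameter)
include hP

theorem sub_le_graphCost_update (hq : ∀ i, Settled ε₀ q i) (k : Fin m) (v : 𝒮.V) :
    𝒮.graphCost q - ε₀ ≤ 𝒮.graphCost (update q k v) := by
  have : Nonempty (Fin m) := ⟨k⟩
  obtain ⟨i, hv, -⟩ := existsUnique_mem_part q v
  by_cases guard : 0 < ∑ u ∈ 𝒮.part q i, 𝒮.c u (q i)
  · by_contra! improves
    obtain ⟨q', hmove⟩ := exists_localMove hP hv improves.le
    exact hq i guard q' hmove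
  · have nonneg : ∀ u ∈ 𝒮.part q i, 0 ≤ 𝒮.c u (q i) := fun u _ => 𝒮.c_nonneg u (q i)
    have zero := (Finset.sum_eq_zero_iff_of_nonneg nonneg).1
      (le_antisymm (not_lt.1 guard) (Finset.sum_nonneg nonneg)) v hv
    exact (sub_le_self _ ε₀.coe_nonneg).trans (graphCost_le_graphCost_update zero k)

section Termination

variable (hε₀ : 0 < ε₀)
include hε₀

theorem graphCost_lt_of_localMove (hmove : 𝒮.LocalMove ε₀ i q q') :
    𝒮.graphCost q' < 𝒮.graphCost q :=
  (graphCost_le_of_localMove hP hmove).trans_lt (sub_lt_self _ (NNReal.coe_pos.2 hε₀))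

theorem exists_localMoves (i : Fin m) (q : 𝒮.Config m) :
    ∃ q', ReflTransGen (𝒮.LocalMove ε₀ i) q q' ∧ ∀ q'', ¬ 𝒮.LocalMove ε₀ i q' q'' := by
  induction q using (Finite.wellFounded_of_trans_of_irrefl
    (InvImage (· < ·) 𝒮.graphCost)).induction with
  | _ q ih =>
    by_cases hq : ∃ q', 𝒮.LocalMove ε₀ i q q'
    · obtain ⟨q', hmove⟩ := hq
      obtain ⟨q'', run, done⟩ := ih q' (graphCost_lt_of_localMove hP hε₀ hmove)
      exact ⟨q'', run.head hmove, done⟩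
    · exact ⟨q, .refl, not_exists.1 hq⟩

theorem exists_turns (q : 𝒮.Config m) (A : Finset (Fin m)) :
    ∃ q', ReflTransGen (𝒮.Turn ε₀) (q, A) (q', ∅) := by
  induction q using (Finite.wellFounded_of_trans_of_irrefl
    (InvImage (· < ·) 𝒮.graphCost)).induction generalizing A with
  | _ q ih_q =>
    induction A using Finset.strongInduction with
    | H A ih_A =>
      obtain rfl | ⟨i, hi⟩ := A.eq_empty_or_nonempty
      · exact ⟨q, .refl⟩
      suffices ∃ s, 𝒮.Turn ε₀ (q, A) s ∧ ∃ q', ReflTransGen (𝒮.Turn ε₀) s (q', ∅) from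
        let ⟨_, turn, q', turns⟩ := this
        ⟨q', turns.head turn⟩
      by_cases guard : 0 < ∑ u ∈ 𝒮.part q i, 𝒮.c u (q i)
      · obtain ⟨q', run, done⟩ := exists_localMoves hP hε₀ i q
        obtain rfl | run := reflTransGen_iff_eq_or_transGen.1 run
        · exact ⟨_, .noMove _ A i hi guard done, ih_A _ (Finset.erase_ssubset hi)⟩
        · have decreases : 𝒮.graphCost q' < 𝒮.graphCost q :=
            run.trans_induction_on (graphCost_lt_of_localMove hP hε₀) fun _ _ h₁ h₂ => h₂.trans h₁
          exact ⟨_, .moves q q' A i hi guard run done, ih_q q' decreases _⟩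
      · exact ⟨_, .skip q A i hi guard, ih_A _ (Finset.erase_ssubset hi)⟩

end Termination

end Execution

end Problem.Sampling

section Discretization

open MeasureTheory

theorem lintegral_iInf_mul_le_add {α : Type*} {ι : Sort*} [MeasurableSpace α] {μ : Measure α}
    {φ : α → ℝ≥0∞} (hφ : AEMeasurable φ μ) {g g' : α → ι → ℝ≥0∞} {C : ℝ≥0∞}
    (h : ∀ᵐ p ∂μ, ∀ i, g p i ≤ g' p i + C) :
    ∫⁻ p, (⨅ i, g p i) * φ p ∂μ ≤ ∫⁻ p, (⨅ i, g' p i) * φ p ∂μ + C * ∫⁻ p, φ p ∂μ := by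
  rw [← lintegral_const_mul'' C hφ, ← lintegral_add_right' _ (hφ.const_mul C)]
  refine lintegral_mono_ae ?_
  filter_upwards [h] with p hp
  rw [← add_mul, ENNReal.iInf_add]
  gcongr with i
  exact hp i

namespace Problem

variable {n m : ℕ} {P : Problem n}

theorem setLIntegral_iInf_mul_φ_le {ι : Sort*} {g g' : Loc n → ι → ℝ≥0} {C : ℝ≥0}
    (h : ∀ p ∈ P.X, ∀ i, g p i ≤ g' p i + C) :
    ∫⁻ p in P.X, (⨅ i, (g p i : ℝ≥0∞)) * P.φ p ≤
      (∫⁻ p in P.X, (⨅ i, (g' p i : ℝ≥0∞)) * P.φ p) + C := by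
  have mass : C * ∫⁻ p in P.X, (P.φ p : ℝ≥0∞) = C := by rw [P.mass_one, mul_one]
  exact (lintegral_iInf_mul_le_add P.aemeasurable_φ.coe_nnreal_ennreal
    (ae_restrict_of_forall_mem P.isCompact_X.measurableSet fun p hp i =>
      mod_cast h p hp i)).trans_eq (congrArg _ mass)

namespace Sampling

variable {𝒮 : P.Sampling} {ζ : ℝ≥0}

theorem ofReal_w (v : 𝒮.V) :
    ENNReal.ofReal (𝒮.w v) = ∫⁻ p in {p | p ∈ P.X ∧ 𝒮.near p = v}, (P.φ p : ℝ≥0∞) :=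
  ENNReal.ofReal_toReal <| ne_top_of_le_ne_top ENNReal.one_ne_top <|
    (lintegral_mono_set fun _ hp => hp.1).trans_eq P.mass_one

theorem setLIntegral_near (g : 𝒮.V → ℝ≥0∞) (hg : ∀ v, g v ≠ ∞) :
    ∫⁻ p in P.X, g (𝒮.near p) * P.φ p = ∑ v, g v * ENNReal.ofReal (𝒮.w v) := by
  have iUnion_cell : ⋃ v, {p | p ∈ P.X ∧ 𝒮.near p = v} = P.X := by
    ext p
    simp
  have disjoint_cell : Pairwise (Function.onFun Disjoint fun v => {p | p ∈ P.X ∧ 𝒮.near p = v}) :=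
    fun v v' hne => Set.disjoint_left.2 fun p hp hp' => hne (hp.2.symm.trans hp'.2)
  conv_lhs => rw [← iUnion_cell]
  rw [lintegral_iUnion 𝒮.measurableSet_cell disjoint_cell, tsum_fintype]
  refine Finset.sum_congr rfl fun v _ => ?_
  rw [ofReal_w, ← lintegral_const_mul' _ _ (hg v)]
  exact setLIntegral_congr_fun (𝒮.measurableSet_cell v) fun p hp => by simp only [hp.2]

theorem ofReal_graphCost [Nonempty (Fin m)] (q : 𝒮.Config m) : ENNReal.ofReal (𝒮.graphCost q) =
    ∫⁻ p in P.X, (⨅ i, (P.f (P.dist (𝒮.near p) (q i)) : ℝ≥0∞)) * P.φ p := by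
  have iInf_c (v : 𝒮.V) : ⨅ i, 𝒮.c v (q i) = (⨅ i, P.f (P.dist v (q i)) : ℝ≥0) :=
    (NNReal.coe_iInf _).symm
  simp only [← ENNReal.coe_iInf]
  rw [setLIntegral_near (𝒮 := 𝒮) (fun v => ((⨅ i, P.f (P.dist v (q i)) : ℝ≥0) : ℝ≥0∞))
    fun _ => ENNReal.coe_ne_top, graphCost, medianCost, ENNReal.ofReal_sum_of_nonneg]
  · refine Finset.sum_congr rfl fun v _ => ?_
    rw [ENNReal.ofReal_mul (𝒮.w_nonneg v), mul_comm, iInf_c, ENNReal.ofReal_coe_nnreal]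
  · exact fun v _ => mul_nonneg (𝒮.w_nonneg v) (Real.iInf_nonneg fun i => 𝒮.c_nonneg v (q i))

variable (hζ : 𝒮.IsDispersion ζ)
include hζ

theorem f_dist_near_le {p : Loc n} (hp : p ∈ P.X) : P.f (P.dist p (𝒮.near p)) ≤ P.f ζ :=
  P.strictMono_f.monotone (𝒮.dist_near_le_dispersion hζ hp)

theorem cost_loc_le [Nonempty (Fin m)] (q : 𝒮.Config m) :
    P.cost (𝒮.loc q) ≤ ENNReal.ofReal (𝒮.graphCost q) + P.f ζ := by
  rw [ofReal_graphCost]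
  refine setLIntegral_iInf_mul_φ_le fun p hp i => ?_
  have := P.f_dist_triangle hp (𝒮.mem_X (𝒮.near p)) (𝒮.loc_mem_X q i)
  exact (this.trans (add_le_add_left (f_dist_near_le hζ hp) _)).trans_eq (add_comm _ _)

theorem ofReal_graphCost_near_le [Nonempty (Fin m)] {Q : Fin m → Loc n} (hQ : ∀ i, Q i ∈ P.X) :
    ENNReal.ofReal (𝒮.graphCost fun i => 𝒮.near (Q i)) ≤ P.cost Q + 2 * P.f ζ := by
  rw [ofReal_graphCost]
  refine (setLIntegral_iInf_mul_φ_le (C := 2 * P.f ζ) fun p hp i => ?_).trans_eq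
    (by push_cast; rfl)
  have hp' := 𝒮.mem_X (𝒮.near p)
  have hQ' := 𝒮.mem_X (𝒮.near (Q i))
  calc P.f (P.dist (𝒮.near p) (𝒮.near (Q i)))
      ≤ P.f (P.dist p (𝒮.near p)) + (P.f (P.dist p (Q i)) + P.f (P.dist (Q i) (𝒮.near (Q i)))) := by
        rw [P.dist_comm p (𝒮.near p)]
        exact (P.f_dist_triangle hp' hp hQ').trans
          (add_le_add_right (P.f_dist_triangle hp (hQ i) hQ') _)
    _ ≤ P.f ζ + (P.f (P.dist p (Q i)) + P.f ζ) := by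
        gcongr
        exacts [f_dist_near_le hζ hp, f_dist_near_le hζ (hQ i)]
    _ = P.f (P.dist p (Q i)) + 2 * P.f ζ := by ring

end Sampling

end Problem

end Discretization

end Coverage

end

open Coverage Problem.Sampling in
theorem mainTheorem3_general {n m : ℕ} (hm : 0 < m) (P : Coverage.Problem n) (𝒮 : P.Sampling)
    (ζ : NNReal) (hζ : 𝒮.IsDispersion ζ) (ε₀ : NNReal) (hε₀ : 0 < ε₀) (q₀ : 𝒮.Config m) :
    (∃ q, 𝒮.Returns ε₀ q₀ q) ∧
    ∀ q, 𝒮.Returns ε₀ q₀ q → ∀ Q : Fin m → Coverage.Loc n, (∀ i, Q i ∈ P.X) →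
      P.cost (𝒮.loc q) ≤ 5 * P.cost Q + ((11 * P.f ζ + m * ε₀ : NNReal) : ENNReal) := by
  have : Nonempty (Fin m) := ⟨⟨0, hm⟩⟩
  have hP := 𝒮.hasFiniteDiameter hζ
  refine ⟨exists_turns hP hε₀ q₀ Finset.univ, fun q hret Q hQ => ?_⟩
  have discrete : 𝒮.graphCost q ≤ 5 * 𝒮.graphCost (fun i => 𝒮.near (Q i)) + m * ε₀ := by
    simpa only [graphCost, Fintype.card_fin] using
      medianCost_le_five_mul_of_locallyOptimal le_rfl 𝒮.c_comm 𝒮.c_triangle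
        (fun u _ => 𝒮.w_nonneg u) (sub_le_graphCost_update hP (settled_of_returns hret))
        fun i => 𝒮.near (Q i)
  calc P.cost (𝒮.loc q)
      ≤ ENNReal.ofReal (5 * 𝒮.graphCost (fun i => 𝒮.near (Q i)) + m * ε₀) + P.f ζ :=
        (cost_loc_le hζ q).trans (by gcongr)
    _ ≤ 5 * ENNReal.ofReal (𝒮.graphCost fun i => 𝒮.near (Q i)) + m * ε₀ + P.f ζ := by
        gcongr
        refine ENNReal.ofReal_add_le.trans_eq ?_
        simp [ENNReal.ofReal_mul]
    _ ≤ 5 * (P.cost Q + 2 * P.f ζ) + m * ε₀ + P.f ζ := by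
        gcongr
        exact ofReal_graphCost_near_le hζ hQ
    _ = 5 * P.cost Q + ((11 * P.f ζ + m * ε₀ : NNReal) : ENNReal) := by
        push_cast
        ring

theorem mainTheorem3 {n m : ℕ} (hm : 0 < m) (P : Coverage.Problem n) (𝒮 : P.Sampling)
    (ζ : NNReal) (hζ : 𝒮.IsDispersion ζ) (ε₀ : NNReal) (hε₀ : 0 < ε₀) (q₀ : 𝒮.Config m) :
    (∃ q, 𝒮.Returns ε₀ q₀ q) ∧
    ∀ q, 𝒮.Returns ε₀ q₀ q → ∀ Sstar : Fin m → Coverage.Loc n, P.IsOptimal Sstar →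
      P.cost (𝒮.loc q) ≤ 5 * P.cost Sstar + ((21 * P.f ζ + m * ε₀ : NNReal) : ENNReal) :=
  (mainTheorem3_general hm P 𝒮 ζ hζ ε₀ hε₀ q₀).imp_right fun h q hret Sstar hopt =>
    (h q hret Sstar hopt.1).trans (by gcongr; norm_num)
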